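/- Let $\mathfrak g=so(3,1)$ be the complex $6$-dimensional Lie algebra with basis $H_1,H_2,H_3,F_1,F_2,F_3$ and relations $[H_j,H_k]=i\epsilon_{jk\ell}H_\ell$, $[F_j,F_k]=-i\epsilon_{jk\ell}H_\ell$, $[F_j,H_k]=i\epsilon_{jk\ell}F_\ell$, with the conjugate-linear involution $X\mapsto X^*$ fixing these six elements; put $H_\pm=H_1\pm iH_2$, $F_\pm=F_1\pm iF_2$. Let $D_{10}$ be the complex pre-Hilbert space with orthonormal basis $\{\xi_{\ell m}:\ \ell=1,2,\dots,\ m=-\ell,\dots,\ell\}$, let $H_{10}$ be its completion, and let $C_\ell=i\,\frac{\sqrt{(\ell^2-1)\ell^2}}{\ell\sqrt{4\ell^2-1}}$ for $\ell\ge 1$. Let $\rho_{10}$ be the representation of $\mathfrak g$ on $D_{10}$ given by $$\rho_{10}(H_3)\xi_{\ell m}=m\,\xi_{\ell m},\qquad \rho_{10}(H_\pm)\xi_{\ell m}=\sqrt{(\ell\mp m)(\ell\pm m+1)}\,\xi_{\ell,m\pm1},$$ $$\rho_{10}(F_3)\xi_{\ell m}=C_\ell\sqrt{\ell^2-m^2}\,\xi_{\ell-1,m}-C_{\ell+1}\sqrt{(\ell+1)^2-m^2}\,\xi_{\ell+1,m},$$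 $$\rho_{10}(F_\pm)\xi_{\ell m}=\pm C_\ell\sqrt{(\ell\mp m)(\ell\mp m-1)}\,\xi_{\ell-1,m\pm1}\pm C_{\ell+1}\sqrt{(\ell\pm m+1)(\ell\pm m+2)}\,\xi_{\ell+1,m\pm1},$$ where $\xi_{\ell m}=0$ if $(\ell,m)$ is not one of the labels above. A $1$-$\rho_{10}$-cocycle is a linear map $\eta:\mathfrak g\to D_{10}$ with $\eta([X,Y])=\rho_{10}(X)\eta(Y)-\rho_{10}(Y)\eta(X)$ for all $X,Y\in\mathfrak g$; it is a coboundary if there is $v\in D_{10}$ with $\eta(X)=\rho_{10}(X)v$ for all $X\in\mathfrak g$. Then there is a $1$-$\rho_{10}$-cocycle $c$ with $$c(H_3)=c(H_\pm)=0,\qquad c(F_3)=-\tfrac{1}{\sqrt2}\,\xi_{10},\qquad c(F_\pm)=\pm\xi_{1,\pm1}.$$ The cocycle $c$ is not a coboundary. Moreover there is no $\zeta\in H_{10}$ with $c(X)=\rho_{10}(X)\zeta$ for all $X\in\mathfrak g$, where this equation is understood as $\langle\rho_{10}(X^*)v,\zeta\rangle=\langle v,c(X)\rangle$ for all $v\in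 D_{10}$. Every $1$-$\rho_{10}$-cocycle is the sum of a scalar multiple of $c$ and a $1$-$\rho_{10}$-coboundary. -/

import Mathlib

noncomputable section

namespace Lorentz

open Complex

set_option linter.all false

attribute [local instance 100] LieRing.ofAssociativeRing

/-! ### The complex Lie algebra `so(3,1)` with its involution -/

/-- The complexified Lorentz Lie algebra: complex `4 × 4` matrices that are skew-adjoint for the
form `diag(1,1,1,-1)`. -/
abbrev so31 : LieSubalgebra ℂ (Matrix (Fin 3 ⊕ Fin 1) (Fin 3 ⊕ Fin 1) ℂ) :=
  LieAlgebra.Orthogonal.so' (Fin 3) (Fin 1) ℂ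

/-- The matrix `∑ⱼ aⱼ Hⱼ + ∑ⱼ bⱼ Fⱼ`, where `Hⱼ` is `i` times the infinitesimal rotation about the
`j`-th axis and `Fⱼ` is `i` times the infinitesimal boost along the `j`-th axis. -/
def elemMatrix (a b : Fin 3 → ℂ) : Matrix (Fin 3 ⊕ Fin 1) (Fin 3 ⊕ Fin 1) ℂ :=
  I • Matrix.fromBlocks
    !![0, -a 2, a 1; a 2, 0, -a 0; -a 1, a 0, 0]
    !![b 0; b 1; b 2]
    !![b 0, b 1, b 2]
    !![0]

theorem mem_so31_iff (X : Matrix (Fin 3 ⊕ Fin 1) (Fin 3 ⊕ Fin 1) ℂ) :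
    X ∈ so31 ↔ X.transpose * LieAlgebra.Orthogonal.indefiniteDiagonal (Fin 3) (Fin 1) ℂ =
      LieAlgebra.Orthogonal.indefiniteDiagonal (Fin 3) (Fin 1) ℂ * (-X) := by
  rw [so31, LieAlgebra.Orthogonal.so', mem_skewAdjointMatricesLieSubalgebra,
    mem_skewAdjointMatricesSubmodule]
  rfl

theorem elemMatrix_mem (a b : Fin 3 → ℂ) : elemMatrix a b ∈ so31 := by
  rw [mem_so31_iff]
  ext i j
  rcases i with i | i <;> rcases j with j | j <;> fin_cases i <;> fin_cases j <;>
    simp [elemMatrix, LieAlgebra.Orthogonal.indefiniteDiagonal]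

/-- The element `∑ⱼ aⱼ Hⱼ + ∑ⱼ bⱼ Fⱼ` of `so(3,1)`. -/
def elem (a b : Fin 3 → ℂ) : so31 := ⟨elemMatrix a b, elemMatrix_mem a b⟩

/-- The generators `H₁, H₂, H₃` (indexed by `0, 1, 2`). -/
def genH (j : Fin 3) : so31 := elem (Pi.single j 1) 0

/-- The generators `F₁, F₂, F₃` (indexed by `0, 1, 2`). -/
def genF (j : Fin 3) : so31 := elem 0 (Pi.single j 1)

/-! The basis `H₃`, `H_± = H₁ ± i H₂`, `F₃`, `F_± = F₁ ± i F₂` of `so(3,1)`. -/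

def H3 : so31 := genH 2
def Hplus : so31 := genH 0 + I • genH 1
def Hminus : so31 := genH 0 - I • genH 1
def F3 : so31 := genF 2
def Fplus : so31 := genF 0 + I • genF 1
def Fminus : so31 := genF 0 - I • genF 1

/-- The coordinates of an element of `so(3,1)` with respect to `H₁, H₂, H₃`. -/
def coordH : so31 →ₗ[ℂ] (Fin 3 → ℂ) where
  toFun X := ![-I * X.1 (.inl 2) (.inl 1), -I * X.1 (.inl 0) (.inl 2), -I * X.1 (.inl 1) (.inl 0)]
  map_add' X Y := by
    ext j; fin_cases j <;> simp <;> ring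
  map_smul' t X := by
    ext j; fin_cases j <;> simp <;> ring

/-- The coordinates of an element of `so(3,1)` with respect to `F₁, F₂, F₃`. -/
def coordF : so31 →ₗ[ℂ] (Fin 3 → ℂ) where
  toFun X := fun j => -I * X.1 (.inl j) (.inr 0)
  map_add' X Y := by
    ext j; simp; ring
  map_smul' t X := by
    ext j; simp; ring

theorem coordH_elem (a b : Fin 3 → ℂ) : coordH (elem a b) = a := by
  ext j; fin_cases j <;> simp [coordH, elem, elemMatrix, ← mul_assoc]

theorem coordF_elem (a b : Fin 3 → ℂ) : coordF (elem a b) = b := by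
  ext j; fin_cases j <;> simp [coordF, elem, elemMatrix, ← mul_assoc]

theorem elem_coord (X : so31) : elem (coordH X) (coordF X) = X := by
  have hX := (mem_so31_iff X.1).1 X.2
  have h : ∀ i j, _ := fun i j => congrFun (congrFun hX i) j
  simp only [LieAlgebra.Orthogonal.indefiniteDiagonal, Matrix.mul_diagonal, Matrix.diagonal_mul,
    Matrix.transpose_apply, Matrix.neg_apply] at h
  have hd : ∀ j : Fin 3, X.1 (.inl j) (.inl j) = 0 := fun j => by
    have := h (.inl j) (.inl j)
    simp only [Sum.elim_inl] at this
    linear_combination this / 2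
  have h10 := h (.inl 1) (.inl 0)
  have h20 := h (.inl 2) (.inl 0)
  have h21 := h (.inl 2) (.inl 1)
  have h33 := h (.inr 0) (.inr 0)
  have hb : ∀ j : Fin 3, X.1 (.inr 0) (.inl j) = X.1 (.inl j) (.inr 0) := fun j => by
    have := h (.inl j) (.inr 0)
    simp only [Sum.elim_inl, Sum.elim_inr] at this
    linear_combination -this
  simp only [Sum.elim_inl, Sum.elim_inr] at h10 h20 h21 h33
  apply Subtype.ext
  ext i j
  rcases i with i | i <;> rcases j with j | j <;> fin_cases i <;> fin_cases j <;>
    simp [coordH, coordF, elem, elemMatrix, ← mul_assoc, hd, hb] <;>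
    first
    | linear_combination h10 | linear_combination -h10
    | linear_combination h20 | linear_combination -h20
    | linear_combination h21 | linear_combination -h21
    | linear_combination h33 / 2 | linear_combination -h33 / 2

/-- The involution `X ↦ X*` of `so(3,1)`: the conjugate-linear map which is `-1` on the real
Lie algebra of real matrices. -/
def involution (X : so31) : so31 :=
  ⟨-(X.1.map (starRingEnd ℂ)), by
    have hX := (mem_so31_iff X.1).1 X.2
    rw [mem_so31_iff]
    ext i j
    have h := congrArg (starRingEnd ℂ) (congrFun (congrFun hX i) j)
    rcases i with i | i <;> rcases j with j | j <;>
      simp [LieAlgebra.Orthogonal.indefiniteDiagonal, Matrix.mul_diagonal,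
        Matrix.diagonal_mul] at h ⊢ <;>
      first | linear_combination h | linear_combination -h⟩

theorem involution_elem (a b : Fin 3 → ℂ) :
    involution (elem a b) =
      elem (fun j => starRingEnd ℂ (a j)) (fun j => starRingEnd ℂ (b j)) := by
  apply Subtype.ext
  ext i j
  rcases i with i | i <;> rcases j with j | j <;> fin_cases i <;> fin_cases j <;>
    simp [involution, elem, elemMatrix]

theorem involution_genH (j : Fin 3) : involution (genH j) = genH j := by
  rw [genH, involution_elem]
  congr 1
  · ext k; by_cases h : k = j <;> simp [h]
  · ext k; simp

theorem involution_genF (j : Fin 3) : involution (genF j) = genF j := by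
  rw [genF, involution_elem]
  congr 1
  · ext k; simp
  · ext k; by_cases h : k = j <;> simp [h]

theorem lie_elem (a b a' b' : Fin 3 → ℂ) :
    ⁅elem a b, elem a' b'⁆ =
      elem (I • (crossProduct a a' - crossProduct b b'))
        (I • (crossProduct a b' + crossProduct b a')) := by
  apply Subtype.ext
  rw [LieSubalgebra.coe_bracket, Ring.lie_def]
  ext i j
  rcases i with i | i <;> rcases j with j | j <;> fin_cases i <;> fin_cases j <;>
    simp [elem, elemMatrix, Matrix.mul_apply, Fin.sum_univ_three, crossProduct] <;> ring

/-! ### The space `D₁₀` and the operators of the representation -/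

/-- The labels `(ℓ, m)` with `ℓ = 1, 2, …` and `m = -ℓ, …, ℓ`. -/
abbrev Idx : Type := {p : ℤ × ℤ // 1 ≤ p.1 ∧ |p.2| ≤ p.1}

/-- The space `D₁₀` of finite linear combinations of the `ξ_{ℓm}`. -/
abbrev D10 : Type := Idx →₀ ℂ

/-- The basis vector `ξ_{ℓm}`; by convention `ξ_{ℓm} = 0` if `(ℓ, m)` is not a label. -/
def xi (l m : ℤ) : D10 :=
  if h : 1 ≤ l ∧ |m| ≤ l then Finsupp.single ⟨(l, m), h⟩ 1 else 0

/-- The coefficient `C_ℓ`, `ℓ ≥ 1`, for the parameters `ℓ₀ = 1` and `ℓ₁ = 0`. -/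
def coeffC (l : ℤ) : ℂ :=
  I * (√(((l : ℝ) ^ 2 - 1 ^ 2) * ((l : ℝ) ^ 2 - 0 ^ 2)) : ℝ) /
    ((l : ℂ) * (√(4 * (l : ℝ) ^ 2 - 1) : ℝ))

/-- `ρ₁₀(H₃) ξ_{ℓm} = m ξ_{ℓm}`. -/
def opH3 : Module.End ℂ D10 :=
  Finsupp.linearCombination ℂ fun p : Idx => (p.1.2 : ℂ) • xi p.1.1 p.1.2

/-- `ρ₁₀(H_±)` for `s = ±1`. -/
def opH (s : ℤ) : Module.End ℂ D10 :=
  Finsupp.linearCombination ℂ fun p : Idx =>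
    let l := p.1.1
    let m := p.1.2
    ((√(((l - s * m) * (l + s * m + 1) : ℤ) : ℝ) : ℝ) : ℂ) • xi l (m + s)

/-- `ρ₁₀(F₃)`; the coefficients `A_ℓ = i ℓ₀ ℓ₁ / (ℓ (ℓ + 1))` vanish for `ℓ₁ = 0`. -/
def opF3 : Module.End ℂ D10 :=
  Finsupp.linearCombination ℂ fun p : Idx =>
    let l := p.1.1
    let m := p.1.2
    (coeffC l * (√((l ^ 2 - m ^ 2 : ℤ) : ℝ) : ℝ)) • xi (l - 1) m
      - (coeffC (l + 1) * (√(((l + 1) ^ 2 - m ^ 2 : ℤ) : ℝ) : ℝ)) • xi (l + 1) m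

/-- `ρ₁₀(F_±)` for `s = ±1`; again `A_ℓ = 0`. -/
def opF (s : ℤ) : Module.End ℂ D10 :=
  Finsupp.linearCombination ℂ fun p : Idx =>
    let l := p.1.1
    let m := p.1.2
    ((s : ℂ) * coeffC l * (√(((l - s * m) * (l - s * m - 1) : ℤ) : ℝ) : ℝ)) • xi (l - 1) (m + s)
      + ((s : ℂ) * coeffC (l + 1) * (√(((l + s * m + 1) * (l + s * m + 2) : ℤ) : ℝ) : ℝ)) •
          xi (l + 1) (m + s)

/-- The complex number `√n`, equal to `0` for `n ≤ 0`. -/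
def rt (n : ℤ) : ℂ := ((√(n : ℝ) : ℝ) : ℂ)

theorem rt_of_nonpos {n : ℤ} (h : n ≤ 0) : rt n = 0 := by
  have : (n : ℝ) ≤ 0 := by exact_mod_cast h
  simp [rt, Real.sqrt_eq_zero_of_nonpos this]

theorem rt_sq {n : ℤ} (h : 0 ≤ n) : rt n ^ 2 = n := by
  have : (0 : ℝ) ≤ n := by exact_mod_cast h
  rw [rt, ← ofReal_pow, Real.sq_sqrt this]; simp

theorem rt_mul {a b : ℤ} (h : 0 ≤ a) : ((√((a * b : ℤ) : ℝ) : ℝ) : ℂ) = rt a * rt b := by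
  have : (0 : ℝ) ≤ a := by exact_mod_cast h
  rw [rt, rt, ← ofReal_mul, Int.cast_mul, Real.sqrt_mul this]

theorem xi_of_not {l m : ℤ} (h : ¬ (1 ≤ l ∧ |m| ≤ l)) : xi l m = 0 := dif_neg h

theorem coeffC_one : coeffC 1 = 0 := by simp [coeffC]

theorem coeffC_sq {l : ℤ} (h : 1 ≤ l) :
    coeffC l ^ 2 * (4 * (l : ℂ) ^ 2 - 1) = 1 - (l : ℂ) ^ 2 := by
  have h1 : (1 : ℝ) ≤ l := by exact_mod_cast h
  have h2 : (0 : ℝ) ≤ ((l : ℝ) ^ 2 - 1 ^ 2) * ((l : ℝ) ^ 2 - 0 ^ 2) := by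
    apply mul_nonneg <;> nlinarith
  have h3 : (0 : ℝ) < 4 * (l : ℝ) ^ 2 - 1 := by nlinarith
  have h4 : ((4 * (l : ℝ) ^ 2 - 1 : ℝ) : ℂ) = 4 * (l : ℂ) ^ 2 - 1 := by push_cast; ring
  have h5 : 4 * (l : ℂ) ^ 2 - 1 ≠ 0 := by rw [← h4]; exact_mod_cast h3.ne'
  have h6 : (l : ℂ) ≠ 0 := by exact_mod_cast (show l ≠ 0 by omega)
  rw [coeffC, div_pow, mul_pow, mul_pow, ← ofReal_pow, ← ofReal_pow, Real.sq_sqrt h2,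
    Real.sq_sqrt h3.le, h4, I_sq]
  rw [div_mul_eq_mul_div, div_eq_iff (mul_ne_zero (pow_ne_zero 2 h6) h5)]
  push_cast
  ring

theorem linearCombination_xi (f : Idx → D10) {l m : ℤ} (h : 1 ≤ l ∧ |m| ≤ l) :
    Finsupp.linearCombination ℂ f (xi l m) = f ⟨(l, m), h⟩ := by
  simp [xi, h]

theorem opH3_xi (l m : ℤ) : opH3 (xi l m) = (m : ℂ) • xi l m := by
  by_cases h : 1 ≤ l ∧ |m| ≤ l
  · rw [opH3, linearCombination_xi _ h]
  · simp [xi_of_not h]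

theorem opH_one_xi (l m : ℤ) :
    opH 1 (xi l m) = (rt (l - m) * rt (l + m + 1)) • xi l (m + 1) := by
  by_cases h : 1 ≤ l ∧ |m| ≤ l
  · rw [opH, linearCombination_xi _ h]
    have := abs_le.1 h.2
    rw [← rt_mul (by omega)]
    simp
  · rw [xi_of_not h, map_zero]
    by_cases h' : 1 ≤ l ∧ |m + 1| ≤ l
    · rw [abs_le] at h h'
      rw [rt_of_nonpos (n := l + m + 1) (by omega)]; simp
    · simp [xi_of_not h']

theorem opH_neg_one_xi (l m : ℤ) :
    opH (-1) (xi l m) = (rt (l + m) * rt (l - m + 1)) • xi l (m - 1) := by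
  by_cases h : 1 ≤ l ∧ |m| ≤ l
  · rw [opH, linearCombination_xi _ h]
    have := abs_le.1 h.2
    rw [← rt_mul (by omega)]
    simp [sub_eq_add_neg]
  · rw [xi_of_not h, map_zero]
    by_cases h' : 1 ≤ l ∧ |m - 1| ≤ l
    · rw [abs_le] at h h'
      rw [rt_of_nonpos (n := l - m + 1) (by omega)]; simp
    · simp [xi_of_not h']

theorem opF3_xi (l m : ℤ) :
    opF3 (xi l m) = (coeffC l * (rt (l - m) * rt (l + m))) • xi (l - 1) m
      - (coeffC (l + 1) * (rt (l - m + 1) * rt (l + m + 1))) • xi (l + 1) m := by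
  by_cases h : 1 ≤ l ∧ |m| ≤ l
  · rw [opF3, linearCombination_xi _ h]
    have := abs_le.1 h.2
    rw [← rt_mul (by omega), ← rt_mul (by omega)]
    ring_nf
  · rw [xi_of_not h, map_zero, xi_of_not (l := l - 1), smul_zero, zero_sub]
    · by_cases h' : 1 ≤ l + 1 ∧ |m| ≤ l + 1
      · by_cases hl : l = 0
        · subst hl; simp [coeffC_one]
        · rw [abs_le] at h h'
          rcases le_total 0 m with hm | hm
          · rw [rt_of_nonpos (n := l - m + 1) (by omega)]; simp
          · rw [rt_of_nonpos (n := l + m + 1) (by omega)]; simp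
      · simp [xi_of_not h']
    · omega

theorem opF_one_xi (l m : ℤ) :
    opF 1 (xi l m) = (coeffC l * (rt (l - m) * rt (l - m - 1))) • xi (l - 1) (m + 1)
      + (coeffC (l + 1) * (rt (l + m + 1) * rt (l + m + 2))) • xi (l + 1) (m + 1) := by
  by_cases h : 1 ≤ l ∧ |m| ≤ l
  · rw [opF, linearCombination_xi _ h]
    have := abs_le.1 h.2
    rw [← rt_mul (by omega), ← rt_mul (by omega)]
    simp
  · rw [xi_of_not h, map_zero]
    by_cases hl : l = 0
    · subst hl; simp [coeffC_one, xi_of_not]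
    rw [abs_le] at h
    rcases le_total m 0 with hm | hm
    · rw [xi_of_not (l := l - 1) (by rw [abs_le]; omega)]
      by_cases hl : l < 0
      · rw [xi_of_not (l := l + 1) (by omega)]; simp
      · rw [rt_of_nonpos (n := l + m + 1) (by omega)]; simp
    · rw [xi_of_not (l := l + 1) (by rw [abs_le]; omega),
        xi_of_not (l := l - 1) (by rw [abs_le]; omega)]; simp

theorem opF_neg_one_xi (l m : ℤ) :
    opF (-1) (xi l m) = (-coeffC l * (rt (l + m) * rt (l + m - 1))) • xi (l - 1) (m - 1)
      + (-coeffC (l + 1) * (rt (l - m + 1) * rt (l - m + 2))) • xi (l + 1) (m - 1) := by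
  by_cases h : 1 ≤ l ∧ |m| ≤ l
  · rw [opF, linearCombination_xi _ h]
    have := abs_le.1 h.2
    rw [← rt_mul (by omega), ← rt_mul (by omega)]
    simp [sub_eq_add_neg]
  · rw [xi_of_not h, map_zero]
    by_cases hl : l = 0
    · subst hl; simp [coeffC_one, xi_of_not]
    rw [abs_le] at h
    rcases le_total 0 m with hm | hm
    · rw [xi_of_not (l := l - 1) (by rw [abs_le]; omega)]
      by_cases hl : l < 0
      · rw [xi_of_not (l := l + 1) (by omega)]; simp
      · rw [rt_of_nonpos (n := l - m + 1) (by omega)]; simp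
    · rw [xi_of_not (l := l + 1) (by rw [abs_le]; omega),
        xi_of_not (l := l - 1) (by rw [abs_le]; omega)]; simp

theorem end_ext {P Q : Module.End ℂ D10}
    (h : ∀ l m : ℤ, 1 ≤ l → -l ≤ m → m ≤ l → P (xi l m) = Q (xi l m)) : P = Q := by
  refine Finsupp.lhom_ext' fun p => LinearMap.ext_ring ?_
  have := h p.1.1 p.1.2 p.2.1 (abs_le.1 p.2.2).1 (abs_le.1 p.2.2).2
  simpa [xi, p.2.1, p.2.2] using this

theorem coeffC_step {l : ℤ} (h : 1 ≤ l) :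
    coeffC (1 + l) ^ 2 * (2 * (l : ℂ) + 3) = coeffC l ^ 2 * (2 * (l : ℂ) - 1) - 1 := by
  have e1 := coeffC_sq h
  have e2 := coeffC_sq (l := 1 + l) (by omega)
  push_cast at e2
  have h0 : 2 * (l : ℂ) + 1 ≠ 0 := by exact_mod_cast (show 2 * l + 1 ≠ 0 by omega)
  apply mul_left_cancel₀ h0
  linear_combination e2 - e1

/-- The identities between square roots that enter the commutation relations. -/
theorem rt_facts {l m : ℤ} (h1 : 1 ≤ l) (h2 : -l ≤ m) (h3 : m ≤ l) :
    rt (l + m) ^ 2 = l + m ∧ rt (l - m) ^ 2 = l - m ∧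
    rt (1 + l + m) ^ 2 = 1 + l + m ∧ rt (1 + l - m) ^ 2 = 1 + l - m ∧
    rt (2 + l + m) ^ 2 = 2 + l + m ∧ rt (2 + l - m) ^ 2 = 2 + l - m ∧
    rt (l + m) * rt (-1 + l + m) ^ 2 = rt (l + m) * (-1 + l + m) ∧
    rt (l - m) * rt (-1 + l - m) ^ 2 = rt (l - m) * (-1 + l - m) ∧
    coeffC (1 + l) ^ 2 * (2 * (l : ℂ) + 3) = coeffC l ^ 2 * (2 * (l : ℂ) - 1) - 1 := by
  refine ⟨?_, ?_, ?_, ?_, ?_, ?_, ?_, ?_, coeffC_step h1⟩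
  · rw [rt_sq (by omega)]; push_cast; ring
  · rw [rt_sq (by omega)]; push_cast; ring
  · rw [rt_sq (by omega)]; push_cast; ring
  · rw [rt_sq (by omega)]; push_cast; ring
  · rw [rt_sq (by omega)]; push_cast; ring
  · rw [rt_sq (by omega)]; push_cast; ring
  · by_cases h : l + m = 0
    · simp [rt_of_nonpos h.le]
    · rw [rt_sq (by omega)]; push_cast; ring
  · by_cases h : l - m = 0
    · simp [rt_of_nonpos h.le]
    · rw [rt_sq (by omega)]; push_cast; ring

theorem comm_H3_Hp : opH3 * opH 1 = opH 1 * opH3 + opH 1 := by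
  refine end_ext fun l m h1 h2 h3 => ?_
  simp only [LinearMap.add_apply, Module.End.mul_apply, map_smul, map_add, map_sub,
    opH3_xi, opH_one_xi]
  ring_nf
  match_scalars <;> ring_nf

theorem comm_H3_Hm : opH3 * opH (-1) = opH (-1) * opH3 + (-opH (-1)) := by
  refine end_ext fun l m h1 h2 h3 => ?_
  simp only [LinearMap.add_apply, Module.End.mul_apply, map_smul, map_add, map_sub,
    LinearMap.neg_apply, opH3_xi, opH_neg_one_xi]
  ring_nf
  match_scalars <;> ring_nf

theorem comm_H3_F3 : opH3 * opF3 = opF3 * opH3 + 0 := by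
  refine end_ext fun l m h1 h2 h3 => ?_
  simp only [LinearMap.add_apply, Module.End.mul_apply, map_smul, map_add, map_sub,
    LinearMap.zero_apply, opH3_xi, opF3_xi]
  ring_nf
  match_scalars <;> ring_nf

theorem comm_H3_Fp : opH3 * opF 1 = opF 1 * opH3 + opF 1 := by
  refine end_ext fun l m h1 h2 h3 => ?_
  simp only [LinearMap.add_apply, Module.End.mul_apply, map_smul, map_add, map_sub,
    opH3_xi, opF_one_xi]
  ring_nf
  match_scalars <;> ring_nf

theorem comm_H3_Fm : opH3 * opF (-1) = opF (-1) * opH3 + (-opF (-1)) := by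
  refine end_ext fun l m h1 h2 h3 => ?_
  simp only [LinearMap.add_apply, Module.End.mul_apply, map_smul, map_add, map_sub,
    LinearMap.neg_apply, opH3_xi, opF_neg_one_xi]
  ring_nf
  match_scalars <;> ring_nf

theorem comm_Hp_Hm : opH 1 * opH (-1) = opH (-1) * opH 1 + (2 : ℂ) • opH3 := by
  refine end_ext fun l m h1 h2 h3 => ?_
  simp only [LinearMap.add_apply, Module.End.mul_apply, map_smul, map_add, map_sub,
    LinearMap.smul_apply, opH_one_xi, opH_neg_one_xi, opH3_xi]
  ring_nf
  obtain ⟨e1, e2, e3, e4, e5, e6, e7, e8, e9⟩ := rt_facts h1 h2 h3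
  match_scalars <;> ring_nf <;> grind

theorem comm_Hp_F3 : opH 1 * opF3 = opF3 * opH 1 + (-opF 1) := by
  refine end_ext fun l m h1 h2 h3 => ?_
  simp only [LinearMap.add_apply, Module.End.mul_apply, map_smul, map_add, map_sub,
    LinearMap.neg_apply, opH_one_xi, opF3_xi, opF_one_xi]
  ring_nf
  obtain ⟨e1, e2, e3, e4, e5, e6, e7, e8, e9⟩ := rt_facts h1 h2 h3
  match_scalars <;> ring_nf <;> grind

theorem comm_Hm_F3 : opH (-1) * opF3 = opF3 * opH (-1) + opF (-1) := by
  refine end_ext fun l m h1 h2 h3 => ?_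
  simp only [LinearMap.add_apply, Module.End.mul_apply, map_smul, map_add, map_sub,
    opH_neg_one_xi, opF3_xi, opF_neg_one_xi]
  ring_nf
  obtain ⟨e1, e2, e3, e4, e5, e6, e7, e8, e9⟩ := rt_facts h1 h2 h3
  match_scalars <;> ring_nf <;> grind

theorem comm_Hp_Fp : opH 1 * opF 1 = opF 1 * opH 1 + 0 := by
  refine end_ext fun l m h1 h2 h3 => ?_
  simp only [LinearMap.add_apply, Module.End.mul_apply, map_smul, map_add, map_sub,
    LinearMap.zero_apply, opH_one_xi, opF_one_xi]
  ring_nf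
  match_scalars <;> ring_nf

theorem comm_Hm_Fm : opH (-1) * opF (-1) = opF (-1) * opH (-1) + 0 := by
  refine end_ext fun l m h1 h2 h3 => ?_
  simp only [LinearMap.add_apply, Module.End.mul_apply, map_smul, map_add, map_sub,
    LinearMap.zero_apply, opH_neg_one_xi, opF_neg_one_xi]
  ring_nf
  match_scalars <;> ring_nf

theorem comm_Hp_Fm : opH 1 * opF (-1) = opF (-1) * opH 1 + (2 : ℂ) • opF3 := by
  refine end_ext fun l m h1 h2 h3 => ?_
  simp only [LinearMap.add_apply, Module.End.mul_apply, map_smul, map_add, map_sub,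
    LinearMap.smul_apply, opH_one_xi, opF_neg_one_xi, opF3_xi]
  ring_nf
  obtain ⟨e1, e2, e3, e4, e5, e6, e7, e8, e9⟩ := rt_facts h1 h2 h3
  match_scalars <;> ring_nf <;> grind

theorem comm_Hm_Fp : opH (-1) * opF 1 = opF 1 * opH (-1) + (-2 : ℂ) • opF3 := by
  refine end_ext fun l m h1 h2 h3 => ?_
  simp only [LinearMap.add_apply, Module.End.mul_apply, map_smul, map_add, map_sub,
    LinearMap.smul_apply, opH_neg_one_xi, opF_one_xi, opF3_xi]
  ring_nf
  obtain ⟨e1, e2, e3, e4, e5, e6, e7, e8, e9⟩ := rt_facts h1 h2 h3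
  match_scalars <;> ring_nf <;> grind

theorem comm_F3_Fp : opF3 * opF 1 = opF 1 * opF3 + (-opH 1) := by
  refine end_ext fun l m h1 h2 h3 => ?_
  simp only [LinearMap.add_apply, Module.End.mul_apply, map_smul, map_add, map_sub,
    LinearMap.neg_apply, opF3_xi, opF_one_xi, opH_one_xi]
  ring_nf
  obtain ⟨e1, e2, e3, e4, e5, e6, e7, e8, e9⟩ := rt_facts h1 h2 h3
  match_scalars <;> ring_nf <;> grind

theorem comm_F3_Fm : opF3 * opF (-1) = opF (-1) * opF3 + opH (-1) := by
  refine end_ext fun l m h1 h2 h3 => ?_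
  simp only [LinearMap.add_apply, Module.End.mul_apply, map_smul, map_add, map_sub,
    opF3_xi, opF_neg_one_xi, opH_neg_one_xi]
  ring_nf
  obtain ⟨e1, e2, e3, e4, e5, e6, e7, e8, e9⟩ := rt_facts h1 h2 h3
  match_scalars <;> ring_nf <;> grind

theorem comm_Fp_Fm : opF 1 * opF (-1) = opF (-1) * opF 1 + (-2 : ℂ) • opH3 := by
  refine end_ext fun l m h1 h2 h3 => ?_
  simp only [LinearMap.add_apply, Module.End.mul_apply, map_smul, map_add, map_sub,
    LinearMap.smul_apply, opF_one_xi, opF_neg_one_xi, opH3_xi]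
  ring_nf
  obtain ⟨e1, e2, e3, e4, e5, e6, e7, e8, e9⟩ := rt_facts h1 h2 h3
  match_scalars <;> ring_nf <;> grind

/-! ### The representation `ρ₁₀` -/

/-- The linear map determined by the values `ρ₁₀(H₃)`, `ρ₁₀(H_±)`, `ρ₁₀(F₃)`, `ρ₁₀(F_±)`,
using `H₁ = (H₊ + H₋) / 2`, `H₂ = (H₊ - H₋) / (2 i)`, and likewise for `F₁`, `F₂`. -/
def rhoLin : so31 →ₗ[ℂ] Module.End ℂ D10 where
  toFun X :=
    ((coordH X 0 - I * coordH X 1) / 2) • opH 1 + ((coordH X 0 + I * coordH X 1) / 2) • opH (-1)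
      + coordH X 2 • opH3
      + ((coordF X 0 - I * coordF X 1) / 2) • opF 1
      + ((coordF X 0 + I * coordF X 1) / 2) • opF (-1)
      + coordF X 2 • opF3
  map_add' X Y := by
    simp only [map_add, Pi.add_apply]; module
  map_smul' t X := by
    simp only [map_smul, Pi.smul_apply, smul_eq_mul, RingHom.id_apply]; module

theorem rhoLin_lie (X Y : so31) :
    rhoLin ⁅X, Y⁆ = rhoLin X * rhoLin Y - rhoLin Y * rhoLin X := by
  obtain ⟨a, b, rfl⟩ : ∃ a b, elem a b = X := ⟨_, _, elem_coord X⟩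
  obtain ⟨c, d, rfl⟩ : ∃ c d, elem c d = Y := ⟨_, _, elem_coord Y⟩
  rw [lie_elem]
  simp only [rhoLin, LinearMap.coe_mk, AddHom.coe_mk, coordH_elem, coordF_elem]
  simp only [mul_add, add_mul, smul_mul_assoc, mul_smul_comm]
  simp only [comm_H3_Hp, comm_H3_Hm, comm_H3_F3, comm_H3_Fp, comm_H3_Fm, comm_Hp_Hm, comm_Hp_F3, comm_Hm_F3, comm_Hp_Fp, comm_Hm_Fm, comm_Hp_Fm, comm_Hm_Fp, comm_F3_Fp, comm_F3_Fm, comm_Fp_Fm]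
  simp [crossProduct]
  match_scalars <;> ring_nf <;> simp [I_sq] <;> ring

/-- The representation `ρ₁₀` of `so(3,1)` on `D₁₀`. -/
def rho10 : so31 →ₗ⁅ℂ⁆ Module.End ℂ D10 :=
  { rhoLin with map_lie' := fun {X Y} => rhoLin_lie X Y }

theorem rho10_elem (a b : Fin 3 → ℂ) :
    rho10 (elem a b) =
      ((a 0 - I * a 1) / 2) • opH 1 + ((a 0 + I * a 1) / 2) • opH (-1) + a 2 • opH3
        + ((b 0 - I * b 1) / 2) • opF 1 + ((b 0 + I * b 1) / 2) • opF (-1) + b 2 • opF3 := by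
  change rhoLin _ = _
  simp only [rhoLin, LinearMap.coe_mk, AddHom.coe_mk, coordH_elem, coordF_elem]

/-! The values of `ρ₁₀` on the basis elements are the operators above. -/

theorem rho10_H3 : rho10 H3 = opH3 := by
  simp [H3, genH, rho10_elem]

theorem rho10_F3 : rho10 F3 = opF3 := by
  simp [F3, genF, rho10_elem]

theorem rho10_Hplus : rho10 Hplus = opH 1 := by
  simp only [Hplus, genH, map_add, map_smul, rho10_elem]
  simp
  match_scalars <;> ring_nf <;> simp
  norm_num

theorem rho10_Hminus : rho10 Hminus = opH (-1) := by
  simp only [Hminus, genH, map_sub, map_smul, rho10_elem]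
  simp
  match_scalars <;> ring_nf <;> simp
  norm_num

theorem rho10_Fplus : rho10 Fplus = opF 1 := by
  simp only [Fplus, genF, map_add, map_smul, rho10_elem]
  simp
  match_scalars <;> ring_nf <;> simp
  norm_num

theorem rho10_Fminus : rho10 Fminus = opF (-1) := by
  simp only [Fminus, genF, map_sub, map_smul, rho10_elem]
  simp
  match_scalars <;> ring_nf <;> simp
  norm_num

/-! ### The Hilbert space `H₁₀`, cocycles and coboundaries -/

/-- The completion `H₁₀` of `D₁₀` for the inner product making the `ξ_{ℓm}` orthonormal,
realised as the space of square-summable families indexed by the labels. -/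
abbrev H10 : Type := lp (fun _ : Idx => ℂ) 2

/-- The inclusion of `D₁₀` in its completion. -/
def incl : D10 →ₗ[ℂ] H10 :=
  Finsupp.linearCombination ℂ fun p : Idx => (lp.single 2 p (1 : ℂ) : H10)

/-- `c` is a `1`-cocycle for the representation `ρ`. -/
def IsOneCocycle {D : Type*} [AddCommGroup D] [Module ℂ D] (ρ : so31 →ₗ⁅ℂ⁆ Module.End ℂ D)
    (c : so31 →ₗ[ℂ] D) : Prop :=
  ∀ X Y : so31, c ⁅X, Y⁆ = ρ X (c Y) - ρ Y (c X)

/-- `c` is a `1`-coboundary for the representation `ρ`: there is `v ∈ D` such that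
`c(X) = ρ(X) v` for all `X`. -/
def IsOneCoboundary {D : Type*} [AddCommGroup D] [Module ℂ D] (ρ : so31 →ₗ⁅ℂ⁆ Module.End ℂ D)
    (c : so31 →ₗ[ℂ] D) : Prop :=
  ∃ v : D, ∀ X : so31, c X = ρ X v

/-- `c` is the coboundary of a vector `ζ` of the completion `H₁₀`: one has `c(X) = ρ₁₀(X) ζ` for
all `X`, where `ρ₁₀(X)` is extended to (a subspace of) `H₁₀` as the adjoint of the densely defined
operator `ρ₁₀(X*)`, that is, `⟨ρ₁₀(X*) v, ζ⟩ = ⟨v, c(X)⟩` for all `v ∈ D₁₀`. This is the largest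
extension: it acts on the formal series `ζ = ∑ x_{ℓm} ξ_{ℓm}` term by term. -/
def IsCoboundaryOfCompletion (c : so31 →ₗ[ℂ] D10) (ζ : H10) : Prop :=
  ∀ (X : so31) (v : D10),
    inner ℂ (incl (rho10 (involution X) v)) ζ = inner ℂ (incl v) (incl (c X))


theorem inner_xi (l m l' m' : ℤ) :
    inner ℂ (incl (xi l m)) (incl (xi l' m')) =
      if (1 ≤ l ∧ |m| ≤ l) ∧ l = l' ∧ m = m' then (1 : ℂ) else 0 := by
  by_cases h : 1 ≤ l ∧ |m| ≤ l
  · by_cases h' : 1 ≤ l' ∧ |m'| ≤ l'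
    · simp [xi, h, h', incl, lp.inner_single_left, Pi.single_apply, Subtype.ext_iff, Prod.ext_iff]
    · have : ¬ ((1 ≤ l ∧ |m| ≤ l) ∧ l = l' ∧ m = m') := by rintro ⟨a, rfl, rfl⟩; exact h' a
      simp [xi_of_not h', this]
  · simp [xi_of_not h, h]

theorem adj_ext {P Q : Module.End ℂ D10}
    (h : ∀ l m l' m' : ℤ, (1 ≤ l ∧ |m| ≤ l) → (1 ≤ l' ∧ |m'| ≤ l') →
      inner ℂ (incl (P (xi l m))) (incl (xi l' m')) =
        inner ℂ (incl (xi l m)) (incl (Q (xi l' m')))) (v w : D10) :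
    inner ℂ (incl (P v)) (incl w) = inner ℂ (incl v) (incl (Q w)) := by
  induction v using Finsupp.induction_linear with
  | zero => simp
  | add f g hf hg => simp only [map_add, inner_add_left, hf, hg]
  | single p a =>
    induction w using Finsupp.induction_linear with
    | zero => simp
    | add f g hf hg => simp only [map_add, inner_add_right, hf, hg]
    | single q b =>
      have e1 : Finsupp.single p a = a • xi p.1.1 p.1.2 := by simp [xi, p.2.1, p.2.2]
      have e2 : Finsupp.single q b = b • xi q.1.1 q.1.2 := by simp [xi, q.2.1, q.2.2]
      rw [e1, e2]
      simp only [map_smul, inner_smul_left, inner_smul_right]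
      rw [h _ _ _ _ p.2 q.2]

theorem conj_rt (n : ℤ) : starRingEnd ℂ (rt n) = rt n := conj_ofReal _
theorem conj_coeffC (l : ℤ) : starRingEnd ℂ (coeffC l) = -coeffC l := by
  simp only [coeffC, map_div₀, map_mul, conj_I, conj_ofReal, map_intCast]; ring

theorem adj_H3 (v w : D10) : inner ℂ (incl (opH3 v)) (incl w) = inner ℂ (incl v) (incl (opH3 w)) := by
  refine adj_ext (fun l m l' m' h h' => ?_) v w
  simp only [opH3_xi, map_smul, inner_smul_left, inner_smul_right, inner_xi, map_intCast]
  split_ifs with h1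
  · simp [h1.2.2]
  · simp

theorem adj_H (v w : D10) : inner ℂ (incl (opH 1 v)) (incl w) = inner ℂ (incl v) (incl (opH (-1) w)) := by
  refine adj_ext (fun l m l' m' h h' => ?_) v w
  simp only [opH_one_xi, opH_neg_one_xi, map_smul, inner_smul_left, inner_smul_right, inner_xi, map_mul, conj_rt]
  by_cases h1 : l' = l ∧ m' = m + 1
  · obtain ⟨rfl, rfl⟩ := h1
    simp [h, h']; ring_nf
  · rw [if_neg, if_neg] <;> grind

theorem adj_F3 (v w : D10) : inner ℂ (incl (opF3 v)) (incl w) = inner ℂ (incl v) (incl (opF3 w)) := by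
  refine adj_ext (fun l m l' m' h h' => ?_) v w
  simp only [opF3_xi, map_smul, map_sub, inner_sub_left, inner_sub_right, inner_smul_left, inner_smul_right, inner_xi, map_mul, conj_rt, conj_coeffC]
  by_cases h1 : l' = l - 1 ∧ m' = m
  · obtain ⟨rfl, rfl⟩ := h1
    rw [if_pos ⟨h', rfl, rfl⟩, if_neg (by omega), if_neg (by omega), if_pos ⟨h, by ring, rfl⟩]; ring_nf
  by_cases h2 : l' = l + 1 ∧ m' = m
  · obtain ⟨rfl, rfl⟩ := h2
    rw [if_neg (by omega), if_pos ⟨h', rfl, rfl⟩, if_pos ⟨h, by ring, rfl⟩, if_neg (by omega)]; ring_nf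
  · rw [if_neg, if_neg, if_neg, if_neg] <;> grind

theorem adj_F (v w : D10) : inner ℂ (incl (opF 1 v)) (incl w) = inner ℂ (incl v) (incl (opF (-1) w)) := by
  refine adj_ext (fun l m l' m' h h' => ?_) v w
  simp only [opF_one_xi, opF_neg_one_xi, map_smul, map_add, inner_add_left, inner_add_right, inner_smul_left, inner_smul_right, inner_xi, map_mul, map_neg, conj_rt, conj_coeffC]
  by_cases h1 : l' = l - 1 ∧ m' = m + 1
  · obtain ⟨rfl, rfl⟩ := h1
    rw [if_pos ⟨h', rfl, rfl⟩, if_neg (by omega), if_neg (by omega), if_pos ⟨h, by ring, by ring⟩]; ring_nf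
  by_cases h2 : l' = l + 1 ∧ m' = m + 1
  · obtain ⟨rfl, rfl⟩ := h2
    rw [if_neg (by omega), if_pos ⟨h', rfl, rfl⟩, if_pos ⟨h, by ring, by ring⟩, if_neg (by omega)]; ring_nf
  · rw [if_neg, if_neg, if_neg, if_neg] <;> grind

/-- `ρ₁₀(X*)` is the formal adjoint of `ρ₁₀(X)` on `D₁₀`. -/
theorem rho10_involution (X : so31) (v w : D10) :
    inner ℂ (incl (rho10 (involution X) v)) (incl w) = inner ℂ (incl v) (incl (rho10 X w)) := by
  have swap : ∀ {P Q : Module.End ℂ D10},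
      (∀ v w, inner ℂ (incl (P v)) (incl w) = inner ℂ (incl v) (incl (Q w))) →
      ∀ v w, inner ℂ (incl (Q v)) (incl w) = inner ℂ (incl v) (incl (P w)) := fun h v w => by
    rw [← inner_conj_symm, ← h, inner_conj_symm]
  obtain ⟨a, b, rfl⟩ : ∃ a b, elem a b = X := ⟨_, _, elem_coord X⟩
  rw [involution_elem, rho10_elem, rho10_elem]
  simp only [LinearMap.add_apply, LinearMap.smul_apply, map_add, map_smul, inner_add_left,
    inner_add_right, inner_smul_left, inner_smul_right, adj_H3, adj_H, adj_F3, adj_F,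
    swap adj_H, swap adj_F, map_sub, map_mul, map_div₀, conj_I, conj_conj, map_ofNat]
  ring

end Lorentz

end

namespace Lorentz

open Complex

/-! ### The standard basis of `so(3,1)` -/

/-! Everything rests on restricting to the subalgebra `so(3)` spanned by the `H`'s. Under it `D10`
is the direct sum of the irreducible modules of spin `ℓ = 1, 2, …`, each occurring once. The trivial
module is absent, and the Casimir operator acts by `ℓ (ℓ + 1) ≠ 0`, so it can be inverted.

Classification: inverting the Casimir operator gives Whitehead's lemma for `so(3)`, so every cocycle
agrees on the `H`'s with a coboundary (`IsOneCocycle.exists_eq_on_H`). After subtracting it, the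
cocycle vanishes on `so(3)`. The cocycle identity then makes it an `so(3)`-equivariant map from the
span of the `F`'s, a spin-one module, to `D10`. Spin one has multiplicity one there, so by Schur the
map is fixed up to a scalar (`IsOneCocycle.eq_smul_cocycleC`); concretely, the image of `Fplus` is a
highest weight vector of weight `1`.

Nontriviality: a vector `ζ` of the completion with coboundary `c` would be `so(3)`-invariant,
because `c` vanishes on the `H`'s. There are no nonzero invariants, so `ζ` is orthogonal to `D10`,
contradicting `c Fplus = xi 1 1 ≠ 0`. Coboundaries of vectors of `D10` are a special case. -/

theorem H3_eq_elem : H3 = elem ![0, 0, 1] 0 := by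
  apply Subtype.ext; ext i j
  rcases i with i | i <;> rcases j with j | j <;> fin_cases i <;> fin_cases j <;>
    simp [H3, genH, elem, elemMatrix]

theorem Hplus_eq_elem : Hplus = elem ![1, I, 0] 0 := by
  apply Subtype.ext; ext i j
  rcases i with i | i <;> rcases j with j | j <;> fin_cases i <;> fin_cases j <;>
    simp [Hplus, genH, elem, elemMatrix]

theorem Hminus_eq_elem : Hminus = elem ![1, -I, 0] 0 := by
  apply Subtype.ext; ext i j
  rcases i with i | i <;> rcases j with j | j <;> fin_cases i <;> fin_cases j <;>
    simp [Hminus, genH, elem, elemMatrix]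

theorem F3_eq_elem : F3 = elem 0 ![0, 0, 1] := by
  apply Subtype.ext; ext i j
  rcases i with i | i <;> rcases j with j | j <;> fin_cases i <;> fin_cases j <;>
    simp [F3, genF, elem, elemMatrix]

theorem Fplus_eq_elem : Fplus = elem 0 ![1, I, 0] := by
  apply Subtype.ext; ext i j
  rcases i with i | i <;> rcases j with j | j <;> fin_cases i <;> fin_cases j <;>
    simp [Fplus, genF, elem, elemMatrix]

theorem Fminus_eq_elem : Fminus = elem 0 ![1, -I, 0] := by
  apply Subtype.ext; ext i j
  rcases i with i | i <;> rcases j with j | j <;> fin_cases i <;> fin_cases j <;>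
    simp [Fminus, genF, elem, elemMatrix]

theorem smul_elem (t : ℂ) (a b : Fin 3 → ℂ) : t • elem a b = elem (t • a) (t • b) := by
  apply Subtype.ext; ext i j
  rcases i with i | i <;> rcases j with j | j <;> fin_cases i <;> fin_cases j <;>
    simp [elem, elemMatrix] <;> ring

theorem add_elem (a b a' b' : Fin 3 → ℂ) : elem a b + elem a' b' = elem (a + a') (b + b') := by
  apply Subtype.ext; ext i j
  rcases i with i | i <;> rcases j with j | j <;> fin_cases i <;> fin_cases j <;>
    simp [elem, elemMatrix] <;> ring

/-- The coefficients come from `H₁ = (H₊ + H₋) / 2` and `H₂ = (H₊ - H₋) / (2i)`, and likewise for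
the `F`'s. -/
theorem elem_eq_basis (a b : Fin 3 → ℂ) :
    elem a b = ((a 0 - I * a 1) / 2) • Hplus + ((a 0 + I * a 1) / 2) • Hminus + a 2 • H3
      + ((b 0 - I * b 1) / 2) • Fplus + ((b 0 + I * b 1) / 2) • Fminus + b 2 • F3 := by
  simp only [Hplus_eq_elem, Hminus_eq_elem, H3_eq_elem, Fplus_eq_elem, Fminus_eq_elem,
    F3_eq_elem, smul_elem, add_elem]
  congr 1 <;> ext j <;> fin_cases j <;> simp <;> ring_nf <;> simp [I_sq]

/-- Linear maps on `so(3,1)` agree if they agree on the standard basis. -/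
theorem so31_hom_ext {D : Type*} [AddCommGroup D] [Module ℂ D] {f g : so31 →ₗ[ℂ] D}
    (h3 : f H3 = g H3) (hp : f Hplus = g Hplus) (hm : f Hminus = g Hminus)
    (f3 : f F3 = g F3) (fp : f Fplus = g Fplus) (fm : f Fminus = g Fminus) : f = g := by
  ext X
  rw [← elem_coord X, elem_eq_basis]
  simp only [map_add, map_smul, h3, hp, hm, f3, fp, fm]

/-! ### Brackets of the standard basis needed for the classification. -/

theorem lie_H3_Hplus : ⁅H3, Hplus⁆ = Hplus := by
  simp only [H3_eq_elem, Hplus_eq_elem, lie_elem]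
  congr 1 <;> ext j <;> fin_cases j <;> simp [crossProduct]

theorem lie_H3_Hminus : ⁅H3, Hminus⁆ = -Hminus := by
  rw [← neg_one_smul ℂ]
  simp only [H3_eq_elem, Hminus_eq_elem, lie_elem, smul_elem]
  congr 1 <;> ext j <;> fin_cases j <;> simp [crossProduct]

theorem lie_Hplus_Hminus : ⁅Hplus, Hminus⁆ = (2 : ℂ) • H3 := by
  simp only [H3_eq_elem, Hplus_eq_elem, Hminus_eq_elem, lie_elem, smul_elem]
  congr 1 <;> ext j <;> fin_cases j <;> simp [crossProduct]
  ring_nf; simp [I_sq]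

theorem lie_H3_Fplus : ⁅H3, Fplus⁆ = Fplus := by
  simp only [H3_eq_elem, Fplus_eq_elem, lie_elem]
  congr 1 <;> ext j <;> fin_cases j <;> simp [crossProduct]

theorem lie_Hplus_Fplus : ⁅Hplus, Fplus⁆ = 0 := by
  -- Zero is written as a multiple of `H3` so that both sides take the form `elem _ _`.
  rw [← zero_smul ℂ H3]
  simp only [H3_eq_elem, Hplus_eq_elem, Fplus_eq_elem, lie_elem, smul_elem]
  congr 1 <;> ext j <;> fin_cases j <;> simp [crossProduct]

theorem lie_Hminus_Fplus : ⁅Hminus, Fplus⁆ = (-2 : ℂ) • F3 := by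
  simp only [F3_eq_elem, Hminus_eq_elem, Fplus_eq_elem, lie_elem, smul_elem]
  congr 1 <;> ext j <;> fin_cases j <;> simp [crossProduct]
  ring_nf; simp [I_sq]

theorem lie_Hminus_F3 : ⁅Hminus, F3⁆ = Fminus := by
  simp only [F3_eq_elem, Hminus_eq_elem, Fminus_eq_elem, lie_elem]
  congr 1 <;> ext j <;> fin_cases j <;> simp [crossProduct]

/-! ### The cocycle -/

/-- The linear map vanishing on `H₃`, `H_±`, with `F₃ ↦ -ξ₁₀/√2` and `F_± ↦ ±ξ_{1,±1}`. -/
noncomputable def cocycleC : so31 →ₗ[ℂ] D10 where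
  toFun X :=
    -- The two halves are the coordinates along `Fplus` and `Fminus`; the second sign is that of `F₋
    -- ↦ -ξ_{1,-1}`, and `rt 2 / 2` is `1 / √2`.
    ((coordF X 0 - I * coordF X 1) / 2) • xi 1 1
      - ((coordF X 0 + I * coordF X 1) / 2) • xi 1 (-1)
      - (coordF X 2 * (rt 2 / 2)) • xi 1 0
  map_add' X Y := by
    simp only [map_add, Pi.add_apply]; module
  map_smul' t X := by
    simp only [map_smul, Pi.smul_apply, smul_eq_mul, RingHom.id_apply]; module

theorem cocycleC_elem (a b : Fin 3 → ℂ) :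
    cocycleC (elem a b) = ((b 0 - I * b 1) / 2) • xi 1 1 - ((b 0 + I * b 1) / 2) • xi 1 (-1)
      - (b 2 * (rt 2 / 2)) • xi 1 0 := by
  simp only [cocycleC, LinearMap.coe_mk, AddHom.coe_mk, coordF_elem]

theorem rt_zero : rt 0 = 0 := by simp [rt]

theorem rt_one : rt 1 = 1 := by simp [rt]

theorem rt_two_sq : rt 2 ^ 2 = 2 := by simpa using rt_sq (n := 2) (by norm_num)

theorem rt_two_ne_zero : rt 2 ≠ 0 := fun h => by simpa [h] using rt_two_sq

theorem rt_four : rt 4 = 2 := by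
  rw [rt, show (((4 : ℤ) : ℝ)) = 2 ^ 2 by norm_num, Real.sqrt_sq (by norm_num)]; simp

theorem neg_one_div_sqrt_two : (-(1 / (√2 : ℝ)) : ℂ) = -(rt 2 / 2) := by
  have h : ((√2 : ℝ) : ℂ) = rt 2 := by simp [rt]
  -- Only the complex denominator `2` is rewritten; the argument of `rt` is an integer.
  rw [h, ← rt_two_sq]
  have := rt_two_ne_zero
  field_simp

/-- The `[H, F]` relations say that the chosen multiples of the `ξ_{1m}` transform under `so(3)` as
the `F`'s do. The `[F, F]` relations require the antisymmetrised action of the `F`'s on these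
vectors to vanish. That action lands in `ℓ = 2` only, since there is no `ℓ = 0` and the `ℓ = 1`
coefficient is zero, whereas the exterior square of spin one is again spin one and has no `ℓ = 2`
part. The proof verifies this in coordinates. -/
theorem isOneCocycle_cocycleC : IsOneCocycle rho10 cocycleC := by
  intro X Y
  obtain ⟨a, b, rfl⟩ : ∃ a b, elem a b = X := ⟨_, _, elem_coord X⟩
  obtain ⟨c, d, rfl⟩ : ∃ c d, elem c d = Y := ⟨_, _, elem_coord Y⟩
  have h0 : ∀ u v : Fin 3 → ℂ, crossProduct u v 0 = u 1 * v 2 - u 2 * v 1 := fun _ _ => by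
    simp [crossProduct]
  have h1 : ∀ u v : Fin 3 → ℂ, crossProduct u v 1 = u 2 * v 0 - u 0 * v 2 := fun _ _ => by
    simp [crossProduct]
  have h2 : ∀ u v : Fin 3 → ℂ, crossProduct u v 2 = u 0 * v 1 - u 1 * v 0 := fun _ _ => by
    simp [crossProduct]
  rw [lie_elem]
  simp only [cocycleC_elem, Pi.smul_apply, Pi.add_apply, smul_eq_mul, h0, h1, h2, rho10_elem, LinearMap.add_apply, LinearMap.smul_apply, map_sub,
    map_smul, opH_one_xi, opH_neg_one_xi, opH3_xi, opF_one_xi, opF_neg_one_xi, opF3_xi, coeffC_one]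
  norm_num [rt_zero, rt_one, rt_four]
  have h := rt_two_sq
  have hI := I_sq
  match_scalars <;> ring_nf <;> grind

theorem cocycleC_H3 : cocycleC H3 = 0 := by simp [H3_eq_elem, cocycleC_elem]

theorem cocycleC_Hplus : cocycleC Hplus = 0 := by simp [Hplus_eq_elem, cocycleC_elem]

theorem cocycleC_Hminus : cocycleC Hminus = 0 := by simp [Hminus_eq_elem, cocycleC_elem]

theorem cocycleC_F3 : cocycleC F3 = -(rt 2 / 2) • xi 1 0 := by
  simp [F3_eq_elem, cocycleC_elem]

theorem cocycleC_Fplus : cocycleC Fplus = xi 1 1 := by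
  simp [Fplus_eq_elem, cocycleC_elem]

theorem cocycleC_Fminus : cocycleC Fminus = -xi 1 (-1) := by
  simp [Fminus_eq_elem, cocycleC_elem]

/-! ### The cocycle is not a coboundary -/

theorem involution_H3 : involution H3 = H3 := involution_genH 2

theorem involution_Hplus : involution Hplus = Hminus := by
  rw [Hplus_eq_elem, Hminus_eq_elem, involution_elem]
  congr 1 <;> ext j <;> fin_cases j <;> simp

theorem single_eq_smul_xi (p : Idx) (a : ℂ) : Finsupp.single p a = a • xi p.1.1 p.1.2 := by
  simp [xi, p.2.1, p.2.2]

/-- A vector of the completion annihilated by `H₃` and `H₊` is orthogonal to `D₁₀`. -/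
theorem inner_incl_eq_zero {ζ : H10}
    (h3 : ∀ v, inner ℂ (incl (opH3 v)) ζ = 0) (hp : ∀ v, inner ℂ (incl (opH (-1) v)) ζ = 0)
    (v : D10) : inner ℂ (incl v) ζ = 0 := by
  induction v using Finsupp.induction_linear with
  | zero => simp
  | add f g hf hg => simp only [map_add, inner_add_left, hf, hg, add_zero]
  | single p a =>
    obtain ⟨⟨l, m⟩, hl, hm⟩ := p
    rw [single_eq_smul_xi, map_smul, inner_smul_left]
    refine mul_eq_zero_of_right _ ?_
    by_cases h : m = 0
    · subst h
      -- The weight-zero vector is out of reach of `H₃`, but `ξ_{l0}` is a nonzero multiple of `H₋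
      -- ξ_{l1}`; the label `(l, 1)` exists because `l ≥ 1`.
      have := hp (xi l 1)
      rw [opH_neg_one_xi, map_smul, inner_smul_left] at this
      refine (mul_eq_zero.1 this).resolve_left ?_
      rw [map_mul, conj_rt, conj_rt]
      have hl' : (1 : ℤ) ≤ l := hl
      refine mul_ne_zero ?_ ?_ <;> intro h0
      · have := rt_sq (n := l + 1) (by omega)
        rw [h0] at this
        have : ((l + 1 : ℤ) : ℂ) = 0 := by rw [← this]; ring
        have : l + 1 = 0 := by exact_mod_cast this
        omega
      · have := rt_sq (n := l - 1 + 1) (by omega)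
        rw [h0] at this
        have : ((l - 1 + 1 : ℤ) : ℂ) = 0 := by rw [← this]; ring
        have : l - 1 + 1 = 0 := by exact_mod_cast this
        omega
    · have := h3 (xi l m)
      rw [opH3_xi, map_smul, inner_smul_left] at this
      refine (mul_eq_zero.1 this).resolve_left ?_
      simpa using h

/-- Vanishing of the cocycle on `H3` and `Hplus` makes `ζ` orthogonal to the ranges of `opH3` and
`opH (-1)`, the latter because `Hplus* = Hminus`. Hence `ζ` is orthogonal to `D10`, while pairing
the equation for `Fplus` with `ξ₁₁` would give `0 = 1`. -/
theorem not_isCoboundaryOfCompletion_cocycleC (ζ : H10) :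
    ¬ IsCoboundaryOfCompletion cocycleC ζ := by
  intro h
  have h0 := inner_incl_eq_zero (ζ := ζ)
    (fun v => by
      have := h H3 v
      rwa [involution_H3, rho10_H3, cocycleC_H3, map_zero, inner_zero_right] at this)
    (fun v => by
      have := h Hplus v
      rwa [involution_Hplus, rho10_Hminus, cocycleC_Hplus, map_zero, inner_zero_right] at this)
  have h1 := h Fplus (xi 1 1)
  rw [h0, cocycleC_Fplus, inner_xi] at h1
  norm_num at h1

/-- By formal adjointness, `ζ` can be the given vector itself. Thus the obstruction in the
completion also rules out coboundaries in `D10`. -/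
theorem IsOneCoboundary.isCoboundaryOfCompletion {c : so31 →ₗ[ℂ] D10}
    (h : IsOneCoboundary rho10 c) : ∃ ζ : H10, IsCoboundaryOfCompletion c ζ := by
  obtain ⟨w, hw⟩ := h
  exact ⟨incl w, fun X v => by rw [hw, rho10_involution]⟩

/-! ### The classification of the cocycles -/

/-- The Casimir operator of `so(3)`. -/
noncomputable def casimir : Module.End ℂ D10 := opH (-1) * opH 1 + opH3 * opH3 + opH3

/-- The inverse of the Casimir operator of `so(3)`. -/
noncomputable def casimirInv : Module.End ℂ D10 :=
  Finsupp.linearCombination ℂ fun p : Idx =>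
    ((p.1.1 : ℂ) * (p.1.1 + 1))⁻¹ • xi p.1.1 p.1.2

theorem casimirInv_xi (l m : ℤ) :
    casimirInv (xi l m) = ((l : ℂ) * (l + 1))⁻¹ • xi l m := by
  by_cases h : 1 ≤ l ∧ |m| ≤ l
  · rw [casimirInv, linearCombination_xi _ h]
  · simp [xi_of_not h]

/-- The Casimir operator is the scalar `ℓ (ℓ + 1)` on spin `ℓ`, nonzero because `ℓ ≥ 1`. -/
theorem casimirInv_mul_casimir : casimirInv * casimir = 1 := by
  refine end_ext fun l m h1 h2 h3 => ?_
  obtain ⟨e1, e2, e3, e4, -⟩ := rt_facts h1 h2 h3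
  have hl : (l : ℂ) ≠ 0 := by exact_mod_cast (show l ≠ 0 by omega)
  have hl' : (l : ℂ) + 1 ≠ 0 := by exact_mod_cast (show l + 1 ≠ 0 by omega)
  have key : casimir (xi l m) = ((l : ℂ) * (l + 1)) • xi l m := by
    simp only [casimir, LinearMap.add_apply, Module.End.mul_apply, map_smul, opH_one_xi,
      opH_neg_one_xi, opH3_xi]
    ring_nf at *
    match_scalars
    grind
  rw [Module.End.mul_apply, key, map_smul, casimirInv_xi, smul_smul,
    mul_inv_cancel₀ (mul_ne_zero hl hl'), one_smul, Module.End.one_apply]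

/-- The `H`'s preserve `ℓ`, and `casimirInv` is a scalar for each `ℓ`. -/
theorem opH3_casimirInv (v : D10) : opH3 (casimirInv v) = casimirInv (opH3 v) := by
  have : opH3 * casimirInv = casimirInv * opH3 := end_ext fun l m _ _ _ => by
    simp only [Module.End.mul_apply, casimirInv_xi, opH3_xi, map_smul, smul_smul, mul_comm]
  exact LinearMap.congr_fun this v

theorem opH_one_casimirInv (v : D10) : opH 1 (casimirInv v) = casimirInv (opH 1 v) := by
  have : opH 1 * casimirInv = casimirInv * opH 1 := end_ext fun l m _ _ _ => by
    simp only [Module.End.mul_apply, casimirInv_xi, opH_one_xi, map_smul, smul_smul, mul_comm]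
  exact LinearMap.congr_fun this v

theorem opH_neg_one_casimirInv (v : D10) :
    opH (-1) (casimirInv v) = casimirInv (opH (-1) v) := by
  have : opH (-1) * casimirInv = casimirInv * opH (-1) := end_ext fun l m _ _ _ => by
    simp only [Module.End.mul_apply, casimirInv_xi, opH_neg_one_xi, map_smul, smul_smul, mul_comm]
  exact LinearMap.congr_fun this v

/-- On the subalgebra `so(3)` every cocycle is a coboundary. -/
theorem IsOneCocycle.exists_eq_on_H {η : so31 →ₗ[ℂ] D10} (h : IsOneCocycle rho10 η) :
    ∃ v : D10, η H3 = opH3 v ∧ η Hplus = opH 1 v ∧ η Hminus = opH (-1) v := by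
  have e1 := h H3 Hplus
  have e2 := h H3 Hminus
  have e3 := h Hplus Hminus
  rw [lie_H3_Hplus, rho10_H3, rho10_Hplus] at e1
  rw [lie_H3_Hminus, rho10_H3, rho10_Hminus, map_neg] at e2
  rw [lie_Hplus_Hminus, rho10_Hplus, rho10_Hminus, map_smul] at e3
  have c1 := fun v => LinearMap.congr_fun comm_H3_Hp v
  have c2 := fun v => LinearMap.congr_fun comm_H3_Hm v
  have c3 := fun v => LinearMap.congr_fun comm_Hp_Hm v
  simp only [Module.End.mul_apply, LinearMap.add_apply, LinearMap.neg_apply,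
    LinearMap.smul_apply] at c1 c2 c3
  have hinv : ∀ v, casimirInv (casimir v) = v := LinearMap.congr_fun casimirInv_mul_casimir
  have hcas : ∀ v, casimir v = opH (-1) (opH 1 v) + opH3 (opH3 v) + opH3 v := fun _ => rfl
  have f1 : opH 1 (η H3) = opH3 (η Hplus) - η Hplus := by
    rw [eq_sub_iff_add_eq', ← eq_sub_iff_add_eq]; exact e1
  have f2 : opH3 (η Hminus) = opH (-1) (η H3) - η Hminus := by
    rw [sub_eq_add_neg, e2]; abel
  have f3 : opH 1 (η Hminus) = (2 : ℂ) • η H3 + opH (-1) (η Hplus) := by rw [e3]; abel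
  -- If `η(X) = ρ(X) v` on `so(3)`, then `casimir v` equals the vector in parentheses, which forces
  -- this choice.
  refine ⟨casimirInv (opH (-1) (η Hplus) + opH3 (η H3) + η H3), ?_, ?_, ?_⟩
  · rw [opH3_casimirInv]
    -- Here and below it suffices to show that `casimir (η X)` is `ρ(X)` applied to that vector;
    -- this follows from the cocycle relations `f1`, `f2`, `f3` and the commutators.
    refine (hinv _).symm.trans (congrArg casimirInv ?_)
    rw [hcas]
    simp only [map_add, map_sub, c2, f1]
    abel
  · rw [opH_one_casimirInv]
    refine (hinv _).symm.trans (congrArg casimirInv ?_)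
    rw [hcas]
    have := c1 (η H3)
    rw [f1, map_sub] at this
    simp only [map_add, c3, f1, eq_sub_of_add_eq this.symm]
    module
  · rw [opH_neg_one_casimirInv]
    refine (hinv _).symm.trans (congrArg casimirInv ?_)
    rw [hcas]
    simp only [map_add, map_sub, map_smul, f2, f3, c2]
    module

/-- `opH3` and `casimirInv` are diagonal in the basis `ξ`, so eigenvector equations can be read
coefficient by coefficient. -/
theorem linearCombination_smul_xi_apply (f : Idx → ℂ) (v : D10) (q : Idx) :
    Finsupp.linearCombination ℂ (fun p : Idx => f p • xi p.1.1 p.1.2) v q = f q * v q := by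
  induction v using Finsupp.induction_linear with
  | zero => simp
  | add u w hu hw => simp only [map_add, Finsupp.add_apply, hu, hw, mul_add]
  | single p a =>
    rw [Finsupp.linearCombination_single, ← single_eq_smul_xi, Finsupp.smul_single,
      Finsupp.single_apply, Finsupp.single_apply]
    split_ifs with h
    · rw [h, smul_eq_mul, mul_comm]
    · simp

/-- The highest weight vectors of weight `1` are the multiples of `ξ₁₁`. -/
theorem eq_smul_xi_one_one {v : D10} (h3 : opH3 v = v) (hp : opH 1 v = 0) :
    ∃ t : ℂ, v = t • xi 1 1 := by
  -- On a highest weight vector the term `H₋ H₊` drops out, leaving `m² + m = 2` for `m = 1`.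
  have hc : casimir v = (2 : ℂ) • v := by
    simp only [casimir, LinearMap.add_apply, Module.End.mul_apply, hp, h3, map_zero]
    module
  have hinv : casimirInv ((2 : ℂ) • v) = v := by
    rw [← hc]; exact LinearMap.congr_fun casimirInv_mul_casimir v
  -- The weight forces `m = 1`, and `ℓ (ℓ + 1) = 2` with `ℓ ≥ 1` forces `ℓ = 1`.
  have key : ∀ q : Idx, v q ≠ 0 → q = ⟨(1, 1), by norm_num⟩ := fun q hq => by
    have e1 := DFunLike.congr_fun h3 q
    have e2 := DFunLike.congr_fun hinv q
    rw [opH3, linearCombination_smul_xi_apply, mul_eq_right₀ hq] at e1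
    rw [casimirInv, linearCombination_smul_xi_apply, Finsupp.smul_apply, smul_eq_mul, ← mul_assoc,
      mul_eq_right₀ hq] at e2
    obtain ⟨⟨l, m⟩, hl, hm⟩ := q
    simp only at e1 e2 hl
    have hlC : (l : ℂ) * (l + 1) ≠ 0 := by exact_mod_cast (by positivity : l * (l + 1) ≠ 0)
    rw [inv_mul_eq_iff_eq_mul₀ hlC, mul_one] at e2
    have e2' : 2 = l * (l + 1) := by exact_mod_cast e2
    have e1' : m = 1 := by exact_mod_cast e1
    have : l = 1 := by nlinarith
    subst this e1'
    rfl
  refine ⟨v ⟨(1, 1), by norm_num⟩, ?_⟩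
  rw [← single_eq_smul_xi ⟨(1, 1), by norm_num⟩]
  ext q
  rw [Finsupp.single_apply]
  split_ifs with h
  · rw [h]
  · by_contra hq
    exact h (key q hq).symm

/-- A cocycle vanishing on `so(3)` is a multiple of `cocycleC`. -/
theorem IsOneCocycle.eq_smul_cocycleC {η : so31 →ₗ[ℂ] D10} (h : IsOneCocycle rho10 η)
    (h3 : η H3 = 0) (hp : η Hplus = 0) (hm : η Hminus = 0) : ∃ t : ℂ, η = t • cocycleC := by
  have e1 := h H3 Fplus
  have e2 := h Hplus Fplus
  have e3 := h Hminus Fplus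
  have e4 := h Hminus F3
  rw [lie_H3_Fplus, rho10_H3, h3, map_zero, sub_zero] at e1
  rw [lie_Hplus_Fplus, rho10_Hplus, hp, map_zero, map_zero, sub_zero] at e2
  rw [lie_Hminus_Fplus, rho10_Hminus, hm, map_zero, sub_zero, map_smul] at e3
  rw [lie_Hminus_F3, rho10_Hminus, hm, map_zero, sub_zero] at e4
  -- Since `η` vanishes on the `H`'s, `e1` and `e2` say that `η Fplus` has weight `1` and is killed
  -- by `H₊`.
  obtain ⟨t, ht⟩ := eq_smul_xi_one_one e1.symm e2.symm
  -- The remaining values come by lowering, from `[H₋, F₊] = -2 F₃` and `[H₋, F₃] = F₋`; the factor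
  -- is `H₋ ξ₁₁ = √2 ξ₁₀` divided by `-2`.
  have f3 : η F3 = (-(t * rt 2 / 2)) • xi 1 0 := by
    have : η F3 = (-1 / 2 : ℂ) • ((-2 : ℂ) • η F3) := by rw [smul_smul]; norm_num
    rw [this, e3, ht, map_smul, opH_neg_one_xi]
    norm_num [rt_one]
    module
  refine ⟨t, so31_hom_ext ?_ ?_ ?_ ?_ ?_ ?_⟩
  · simp [h3, cocycleC_H3]
  · simp [hp, cocycleC_Hplus]
  · simp [hm, cocycleC_Hminus]
  · rw [f3, LinearMap.smul_apply, cocycleC_F3]; module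
  · simp [ht, cocycleC_Fplus]
  · rw [e4, f3, map_smul, opH_neg_one_xi, LinearMap.smul_apply, cocycleC_Fminus]
    norm_num [rt_one]
    have := rt_two_sq
    match_scalars
    linear_combination (t / 2) * this

/-- The coboundary of a vector. -/
noncomputable def coboundary (v : D10) : so31 →ₗ[ℂ] D10 where
  toFun X := rho10 X v
  map_add' X Y := by simp
  map_smul' t X := by simp

theorem coboundary_apply (v : D10) (X : so31) : coboundary v X = rho10 X v := rfl

theorem isOneCocycle_sub_coboundary {η : so31 →ₗ[ℂ] D10} (h : IsOneCocycle rho10 η) (v : D10) :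
    IsOneCocycle rho10 (η - coboundary v) := by
  intro X Y
  simp only [LinearMap.sub_apply, h X Y, coboundary_apply, LieHom.map_lie, map_sub,
    Ring.lie_def, Module.End.mul_apply]
  abel

end Lorentz

open Lorentz in
theorem mainTheorem1 :
    ∃ c : so31 →ₗ[ℂ] D10,
      IsOneCocycle rho10 c ∧
      c H3 = 0 ∧ c Hplus = 0 ∧ c Hminus = 0 ∧
      c F3 = (-(1 / (√2 : ℝ)) : ℂ) • xi 1 0 ∧
      c Fplus = xi 1 1 ∧ c Fminus = -xi 1 (-1) ∧
      ¬ IsOneCoboundary rho10 c ∧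
      (¬ ∃ ζ : H10, IsCoboundaryOfCompletion c ζ) ∧
      ∀ η : so31 →ₗ[ℂ] D10, IsOneCocycle rho10 η →
        ∃ (t : ℂ) (b : so31 →ₗ[ℂ] D10), IsOneCoboundary rho10 b ∧ η = t • c + b := by
  have hζ : ¬ ∃ ζ : H10, IsCoboundaryOfCompletion cocycleC ζ := fun ⟨ζ, h⟩ =>
    not_isCoboundaryOfCompletion_cocycleC ζ h
  refine ⟨cocycleC, isOneCocycle_cocycleC, cocycleC_H3, cocycleC_Hplus, cocycleC_Hminus,
    by rw [neg_one_div_sqrt_two, cocycleC_F3], cocycleC_Fplus, cocycleC_Fminus,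
    fun h => hζ h.isCoboundaryOfCompletion, hζ, fun η hη => ?_⟩
  obtain ⟨v, h3, hp, hm⟩ := hη.exists_eq_on_H
  -- Subtracting the coboundary of `v` leaves a cocycle that vanishes on `so(3)`.
  obtain ⟨t, ht⟩ := (isOneCocycle_sub_coboundary hη v).eq_smul_cocycleC
    (by rw [LinearMap.sub_apply, coboundary_apply, rho10_H3, h3, sub_self])
    (by rw [LinearMap.sub_apply, coboundary_apply, rho10_Hplus, hp, sub_self])
    (by rw [LinearMap.sub_apply, coboundary_apply, rho10_Hminus, hm, sub_self])
  exact ⟨t, coboundary v, ⟨v, fun _ => rfl⟩, by rw [← ht]; exact (sub_add_cancel η _).symm⟩
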